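/- For $n\ge 1$ view a permutation $\sigma$ of $\{1,\dots,n\}$ as the word $\sigma_1\sigma_2\cdots\sigma_n$. For $1\le k\le n$ let $\sigma_{[k]}$ be the subword of $\sigma$ consisting of the letters $1,\dots,k$ in the order in which they appear in $\sigma$. In a word $w_1\cdots w_k$, with the convention $w_0=w_{k+1}=0$, a letter $w_i$ is a double descent if $w_{i-1}>w_i>w_{i+1}$. The permutation $\sigma$ is an André permutation if, for all $1\le k\le n$, the word $\sigma_{[k]}$ has no double descents and ends with an ascent (for $k=1$ the last ascent is $w_0=0<1=w_1$). Let $\mathfrak{D}_n$ be the set of André permutations of $\{1,\dots,n\}$. Put $$\operatorname{des}\sigma=\#\{1\le i<n:\sigma_i>\sigma_{i+1}\},$$ $$\operatorname{les}\sigma=\#\{(i,j):2\le i<j\le n,\ \sigma_{i-1}>\sigma_j>\sigma_i\},$$ $$\operatorname{res}\sigma=\#\{(i,j):1\le i<j\le n-1,\ \sigma_{j+1}>\sigma_i>\sigma_j\},$$ let $\mathfrak{D}_{n,k}=\{\sigma\in\mathfrak{D}_n:\operatorname{des}\sigma=k\}$, and $$d_{n,k}(p,q)=\sum_{\sigma\in\mathfrak{D}_{n,k}}p^{\operatorname{res}\sigma}q^{\operatorname{les}\sigma-k}.$$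 Let $p,q,t$ be indeterminates, $[n]_{p,q}=\sum_{i+j=n-1}p^iq^j=\frac{p^n-q^n}{p-q}$ and $\binom{n}{k}_{p,q}=\frac{[n]_{p,q}\cdots[n-k+1]_{p,q}}{[1]_{p,q}\cdots[k]_{p,q}}$ for $0\le k\le n$. Define $D_n(p,q,t)$, $n\ge 1$, by the formal power series expansion $$\sum_{n\ge 0}D_{n+1}(p,q,t)\,x^n=\cfrac{1}{1-b_0x-\cfrac{\lambda_1x^2}{1-b_1x-\cfrac{\lambda_2x^2}{1-b_2x-\cdots}}},\qquad b_m=[m+1]_{p,q}\ (m\ge 0),\quad \lambda_m=\binom{m+1}{2}_{p,q}t\ (m\ge 1).$$ **Theorem.** For every $n\ge 1$ one has $\operatorname{les}\sigma\ge\operatorname{des}\sigma$ for all $\sigma\in\mathfrak{D}_n$ (so the sums below are polynomials in $p,q,t$), and $$D_n(p,q,t)=\sum_{k=0}^{\lfloor (n-1)/2\rfloor}d_{n,k}(p,q)\,t^k=\sum_{\sigma\in\mathfrak{D}_n}p^{\operatorname{res}\sigma}q^{\operatorname{les}\sigma-\operatorname{des}\sigma}t^{\operatorname{des}\sigma}.$$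 -/

import Mathlib

noncomputable section

namespace AndrePermutation

open PowerSeries

/-! Words in positive letters, framed by the letter `0` on both sides. -/

/-- The letter `w_i` of the word `w = w_1 … w_m` (positions start at `1`), with the convention
`w_0 = w_{m+1} = 0`. -/
def letter (w : List ℕ) (i : ℕ) : ℕ :=
  if i = 0 then 0 else w.getD (i - 1) 0

/-- The letter in position `i` of `w` is a double descent (with `w_0 = w_{m+1} = 0`). -/
def IsDoubleDescent (w : List ℕ) (i : ℕ) : Prop :=
  letter w i < letter w (i - 1) ∧ letter w (i + 1) < letter w i

/-- The subword of `w` consisting of its letters `≤ k`, in the order in which they appear. -/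
def subword (w : List ℕ) (k : ℕ) : List ℕ :=
  w.filter (fun a => decide (a ≤ k))

/-- The permutation `σ` of `{1, …, n}` as the word `σ_1 … σ_n` in the letters `1, …, n`.
(`Fin n` is `{0, …, n - 1}`, so both positions and values are shifted by one.) -/
def word {n : ℕ} (σ : Equiv.Perm (Fin n)) : List ℕ :=
  List.ofFn (fun i => (σ i : ℕ) + 1)

/-- `σ` is an André permutation: for `1 ≤ k ≤ n`, the subword `σ_{[k]}` of the letters `1, …, k`
has no double descents and ends with an ascent. (For `k = 1` the last ascent is the step from the
framing letter `0` to `1`.) -/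
def IsAndre {n : ℕ} (σ : Equiv.Perm (Fin n)) : Prop :=
  ∀ k, 1 ≤ k → k ≤ n →
    (∀ i, 1 ≤ i → i ≤ k → ¬ IsDoubleDescent (subword (word σ) k) i) ∧
      letter (subword (word σ) k) (k - 1) < letter (subword (word σ) k) k

/-- Number of descents: `1 ≤ i < n` with `σ_i > σ_{i+1}`. -/
def des {n : ℕ} (σ : Equiv.Perm (Fin n)) : ℕ :=
  ((Finset.Ico 1 n).filter fun i => letter (word σ) (i + 1) < letter (word σ) i).card

/-- Number of pairs `(i, j)` with `2 ≤ i < j ≤ n` and `σ_{i-1} > σ_j > σ_i`. -/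
def les {n : ℕ} (σ : Equiv.Perm (Fin n)) : ℕ :=
  ((Finset.Icc 1 n ×ˢ Finset.Icc 1 n).filter fun x =>
    2 ≤ x.1 ∧ x.1 < x.2 ∧
      letter (word σ) x.2 < letter (word σ) (x.1 - 1) ∧
      letter (word σ) x.1 < letter (word σ) x.2).card

/-- Number of pairs `(i, j)` with `1 ≤ i < j ≤ n - 1` and `σ_{j+1} > σ_i > σ_j`. -/
def res {n : ℕ} (σ : Equiv.Perm (Fin n)) : ℕ :=
  ((Finset.Icc 1 n ×ˢ Finset.Icc 1 n).filter fun x =>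
    x.1 < x.2 ∧ x.2 + 1 ≤ n ∧
      letter (word σ) x.1 < letter (word σ) (x.2 + 1) ∧
      letter (word σ) x.2 < letter (word σ) x.1).card

open scoped Classical in
/-- The set `𝔇_n` of André permutations of `{1, …, n}`. -/
def andre (n : ℕ) : Finset (Equiv.Perm (Fin n)) :=
  Finset.univ.filter fun σ => IsAndre σ

/-- The set `𝔇_{n,k}` of André permutations of `{1, …, n}` with `k` descents. -/
def andreDes (n k : ℕ) : Finset (Equiv.Perm (Fin n)) :=
  (andre n).filter fun σ => des σ = k

/-- `d_{n,k}(p,q) = ∑_{σ ∈ 𝔇_{n,k}} p^{res σ} q^{les σ - k}`; the exponent of `q` is an integer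
(no truncated subtraction). -/
def d {K : Type*} [Field K] (p q : K) (n k : ℕ) : K :=
  ∑ σ ∈ andreDes n k, p ^ res σ * q ^ ((les σ : ℤ) - (k : ℤ))

/-! `(p,q)`-integers and `(p,q)`-binomial coefficients. -/

/-- `[n]_{p,q} = ∑_{i+j=n-1} p^i q^j`. -/
def pqNat {K : Type*} [Field K] (p q : K) (n : ℕ) : K :=
  ∑ i ∈ Finset.range n, p ^ i * q ^ (n - 1 - i)

/-- `[n]_{p,q} = (p^n - q^n) / (p - q)`. -/
theorem pqNat_eq_div {K : Type*} [Field K] {p q : K} (h : p ≠ q) (n : ℕ) :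
    pqNat p q n = (p ^ n - q ^ n) / (p - q) := by
  rw [eq_div_iff (sub_ne_zero.2 h)]
  exact (Commute.all p q).geom_sum₂_mul n

/-- `[n][n-1]⋯[n-k+1] / ([1][2]⋯[k])` for `0 ≤ k ≤ n`. -/
def pqBinom {K : Type*} [Field K] (p q : K) (n k : ℕ) : K :=
  (∏ i ∈ Finset.range k, pqNat p q (n - i)) / (∏ i ∈ Finset.range k, pqNat p q (i + 1))

/-! J-type continued fractions as formal power series. -/

/-- The `N`-th convergent of the J-fraction that starts at level `m`:
`1 / (1 - b_m x - λ_{m+1} x² / (1 - b_{m+1} x - ⋯))` with `N` levels, and `0` for `N = 0`. -/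
def jConvergent {K : Type*} [Field K] (b l : ℕ → K) : ℕ → ℕ → K⟦X⟧
  | 0, _ => 0
  | N + 1, m => (1 - C (b m) * X - C (l (m + 1)) * X ^ 2 * jConvergent b l N (m + 1))⁻¹

/-- The formal power series with J-fraction
`1 / (1 - b_0 x - λ_1 x² / (1 - b_1 x - λ_2 x² / (1 - ⋯)))`: the coefficientwise limit of its
convergents, whose coefficient of `x^n` is constant from the `(n+1)`-st convergent on
(see `coeff_jConvergent`). -/
def jFraction {K : Type*} [Field K] (b l : ℕ → K) : K⟦X⟧ :=
  PowerSeries.mk fun n => coeff n (jConvergent b l (n + 1) 0)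

theorem jConvergent_succ_mul {K : Type*} [Field K] (b l : ℕ → K) (N m : ℕ) :
    jConvergent b l (N + 1) m *
      (1 - C (b m) * X - C (l (m + 1)) * X ^ 2 * jConvergent b l N (m + 1)) = 1 := by
  rw [jConvergent]
  exact PowerSeries.inv_mul_cancel _ (by simp)

theorem X_pow_dvd_jConvergent_sub {K : Type*} [Field K] (b l : ℕ → K) (N r m : ℕ) :
    (X : K⟦X⟧) ^ (2 * N) ∣ jConvergent b l (N + r) m - jConvergent b l N m := by
  induction N generalizing m with
  | zero => simp
  | succ N ih =>
    obtain ⟨e, he⟩ := ih (m + 1)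
    have h1 := jConvergent_succ_mul b l (N + r) m
    have h2 := jConvergent_succ_mul b l N m
    rw [show N + 1 + r = N + r + 1 by omega]
    refine ⟨jConvergent b l (N + r + 1) m * jConvergent b l (N + 1) m * C (l (m + 1)) * e, ?_⟩
    linear_combination (jConvergent b l (N + 1) m) * h1 - (jConvergent b l (N + r + 1) m) * h2 +
      jConvergent b l (N + r + 1) m * jConvergent b l (N + 1) m * C (l (m + 1)) * X ^ 2 * he

/-- The coefficients of the convergents stabilize to those of the J-fraction. -/
theorem coeff_jConvergent {K : Type*} [Field K] (b l : ℕ → K) (n N : ℕ) (h : n < N) :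
    coeff n (jConvergent b l N 0) = coeff n (jFraction b l) := by
  obtain ⟨r, rfl⟩ : ∃ r, N = n + 1 + r := ⟨N - (n + 1), by omega⟩
  have := PowerSeries.X_pow_dvd_iff.1 (X_pow_dvd_jConvergent_sub b l (n + 1) r 0) n (by omega)
  rw [jFraction, coeff_mk]
  simpa [sub_eq_zero] using this

/-- `D_n(p,q,t)` for `n ≥ 1`: the coefficient of `x^{n-1}` in the J-fraction with
`b_m = [m+1]_{p,q}` and `λ_m = binom(m+1, 2)_{p,q} t`. -/
def D {K : Type*} [Field K] (p q t : K) (n : ℕ) : K :=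
  coeff (n - 1)
    (jFraction (fun m => pqNat p q (m + 1)) (fun m => pqBinom p q (m + 1) 2 * t))

/-- The field `ℚ(p,q,t)` of rational functions, as the fraction field of `ℤ[p,q,t]`. -/
abbrev RatFun : Type := FractionRing (MvPolynomial (Fin 3) ℤ)

/-- The indeterminate `p`. -/
def pVar : RatFun := algebraMap (MvPolynomial (Fin 3) ℤ) RatFun (MvPolynomial.X 0)

/-- The indeterminate `q`. -/
def qVar : RatFun := algebraMap (MvPolynomial (Fin 3) ℤ) RatFun (MvPolynomial.X 1)

/-- The indeterminate `t`. -/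
def tVar : RatFun := algebraMap (MvPolynomial (Fin 3) ℤ) RatFun (MvPolynomial.X 2)

end AndrePermutation

end

namespace AndrePermutation

/-! ### Statistics of words -/

/-! A word with smallest letter `x` is André exactly when it is `u x v` with `u`, `v` André and, if
`u` is nonempty, `min v < min u` (`andreWord_append`). Deleting the letters 1, 2, … in turn
therefore leaves a row of runs, some neighbours being bound in pairs whose second run has the
smaller minimum. The next letter lies in a free run or in the second run of a bound pair. Deleting
it frees the first run of that pair and splits its own run into `u` and `v`, which become a bound
pair if `u` is nonempty. The number `m` of nonempty runs thus changes by -1, 0 or 1, and traces a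
lattice path from 1 to 0.

The deleted letter is the `2` of one pattern `31-2` for each nonempty run on its left and of one
pattern `2-13` for each on its right, and it accounts for a descent exactly when the path goes up
(`wordLes_insert`, `wordRes_insert`, `configDes_insert`). If all `m` runs were eligible, their
choice would contribute `[m]`. In a bound pair only the second run is, which leaves `q` of the total
`p + q`. So each bound pair costs a factor `r = q / (p + q)`, and apart from this factor the sum
depends only on `m` (`sum_configs`).

An up step creates a bound pair and so has the extra weight `r * t`. Replacing `t` by `t / q` to
account for `q ^ (-des)` makes this `t / (p + q)`, and first-passage decomposition of the paths
gives the J-fraction (`coeff_jFraction_eq_pathSum`). The bound `des ≤ les` comes from the same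
deletion process (`des_add_count_le`). -/

/-- The number of occurrences of the pattern `31-2` in a word. -/
def wordLes : List ℕ → ℕ
  | a :: b :: t => t.countP (fun x => decide (b < x ∧ x < a)) + wordLes (b :: t)
  | _ => 0

/-- The number of occurrences of the pattern `2-13` in a word. -/
def wordRes (w : List ℕ) : ℕ := wordLes w.reverse

/-- The number of descents of a word. -/
def wordDes : List ℕ → ℕ
  | a :: b :: t => (if b < a then 1 else 0) + wordDes (b :: t)
  | _ => 0

/-- The number of positive letters that are directly followed by the letter `0`. -/
def dropCount : List ℕ → ℕ
  | a :: b :: t => (if 0 < a ∧ b = 0 then 1 else 0) + dropCount (b :: t)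
  | _ => 0

theorem wordLes_zero_cons (w : List ℕ) : wordLes (0 :: w) = wordLes w := by
  cases w <;> simp [wordLes]

theorem wordLes_append_zero (w : List ℕ) : wordLes (w ++ [0]) = wordLes w := by
  induction w with
  | nil => simp [wordLes]
  | cons a w ih =>
    cases w with
    | nil => simp [wordLes]
    | cons b t => simpa [wordLes] using ih

/-- A pair with empty first component puts two separators side by side; merging them affects no
pattern. -/
theorem wordLes_zero_zero (α β : List ℕ) :
    wordLes (α ++ 0 :: 0 :: β) = wordLes (α ++ 0 :: β) := by
  induction α with
  | nil => simp [wordLes_zero_cons]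
  | cons a α ih =>
    cases α with
    | nil => simp [wordLes]
    | cons b t => simpa [wordLes] using ih

theorem wordRes_zero_cons (w : List ℕ) : wordRes (0 :: w) = wordRes w := by
  simp [wordRes, wordLes_append_zero]

theorem wordRes_zero_zero (α β : List ℕ) :
    wordRes (α ++ 0 :: 0 :: β) = wordRes (α ++ 0 :: β) := by
  simpa [wordRes] using wordLes_zero_zero β.reverse α.reverse

/-- The smallest positive letter `c` of a word plays the role of `2` in a pattern `31-2` once for
each drop from a positive letter to `0` on its left. -/
theorem wordLes_replace_min (c : ℕ) (hc : 0 < c) (α β : List ℕ)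
    (hα : ∀ x ∈ α, x = 0 ∨ c < x) (hβ : ∀ x ∈ β, x = 0 ∨ c < x) :
    wordLes (α ++ c :: β) = wordLes (α ++ 0 :: β) + dropCount α := by
  induction α with
  | nil =>
    cases β with
    | nil => simp [wordLes, dropCount]
    | cons b t =>
      have : t.countP (fun x => decide (b < x ∧ x < c)) = 0 := by
        rw [List.countP_eq_zero]
        intro x hx
        have := hβ x (by simp [hx])
        rw [decide_eq_true_eq]
        omega
      rw [List.nil_append, List.nil_append, wordLes_zero_cons, wordLes, this]
      simp [dropCount]
  | cons a α ih =>
    have ih := ih (fun x hx => hα x (by simp [hx]))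
    have ha := hα a (by simp)
    cases α with
    | nil =>
      have : β.countP (fun x => decide (c < x ∧ x < a)) =
          β.countP (fun x => decide (0 < x ∧ x < a)) := by
        apply List.countP_congr
        intro x hx
        have := hβ x hx
        simp
        omega
      simp only [List.cons_append, List.nil_append, wordLes, this, dropCount] at ih ⊢
      omega
    | cons b t =>
      have hb := hα b (by simp)
      have : (if b < c ∧ c < a then 1 else 0) = (if 0 < a ∧ b = 0 then 1 else 0) := by
        congr 1
        simp
        omega
      simp only [List.cons_append, wordLes, dropCount, List.countP_append, List.countP_cons,
        decide_eq_true_eq, this] at ih ⊢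
      simp only [not_lt_zero, false_and, if_false]
      omega

theorem wordDes_append_min (x : ℕ) (u v : List ℕ) (hu : ∀ y ∈ u, x < y) (hv : ∀ y ∈ v, x < y) :
    wordDes (u ++ x :: v) = wordDes u + wordDes v + (if u = [] then 0 else 1) := by
  induction u with
  | nil =>
    cases v with
    | nil => simp [wordDes]
    | cons b t =>
      have := hv b (by simp)
      simp [wordDes, this.le]
  | cons a u ih =>
    have ih := ih (fun y hy => hu y (by simp [hy]))
    have ha := hu a (by simp)
    cases u with
    | nil => simp_all [wordDes]; omega
    | cons b t => simp_all [wordDes]; omega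

theorem dropCount_of_pos (u : List ℕ) (hu : ∀ y ∈ u, 0 < y) : dropCount u = 0 := by
  induction u with
  | nil => simp [dropCount]
  | cons a u ih =>
    cases u with
    | nil => simp [dropCount]
    | cons b t =>
      have := hu b (by simp)
      simp only [dropCount, ih (fun y hy => hu y (by simp [hy]))]
      simp [this.ne']

theorem dropCount_append_zero_cons (u w : List ℕ) :
    dropCount (u ++ 0 :: w) = dropCount (u ++ [0]) + dropCount w := by
  induction u with
  | nil => cases w <;> simp [dropCount]
  | cons a u ih =>
    cases u with
    | nil => cases w <;> simp [dropCount]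
    | cons b t => simp only [List.cons_append, dropCount] at ih ⊢; omega

theorem dropCount_append_singleton_zero (u : List ℕ) (hu : ∀ y ∈ u, 0 < y) :
    dropCount (u ++ [0]) = if u = [] then 0 else 1 := by
  induction u with
  | nil => simp [dropCount]
  | cons a u ih =>
    have ih := ih (fun y hy => hu y (by simp [hy]))
    cases u with
    | nil =>
      have := hu a (by simp)
      simp [dropCount, this]
    | cons b t =>
      have := hu b (by simp)
      simp_all [dropCount]
      omega

/-! ### Comparison with the index-based statistics -/

theorem wordDes_eq (w : List ℕ) :
    ((Finset.Ico 1 w.length).filter fun i => letter w (i + 1) < letter w i).card = wordDes w := by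
  induction w with
  | nil => simp [wordDes]
  | cons a w ih =>
    cases w with
    | nil => simp [wordDes]
    | cons b t =>
      rw [Finset.card_filter] at ih ⊢
      rw [Finset.sum_Ico_eq_sum_range] at ih ⊢
      simp only [List.length_cons, Nat.add_sub_cancel] at ih ⊢
      rw [Finset.sum_range_succ', wordDes, ← ih, add_comm]
      congr 1
      refine Finset.sum_congr rfl fun i _ => ?_
      simp [letter, show 1 + (i + 1) = (1 + i) + 1 by omega]
      simp [Nat.add_comm 1 i]

theorem countP_eq_sum_range (P : ℕ → Bool) (t : List ℕ) :
    t.countP P = ∑ j ∈ Finset.range t.length, if P (t.getD j 0) then 1 else 0 := by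
  induction t with
  | nil => simp
  | cons a t ih =>
    rw [List.length_cons, Finset.sum_range_succ', List.countP_cons, ih]
    simp

theorem wordLes_eq_sum (w : List ℕ) :
    wordLes w = ∑ i ∈ Finset.range w.length, ∑ j ∈ Finset.range w.length,
      if 1 ≤ i ∧ i < j ∧ w.getD j 0 < w.getD (i - 1) 0 ∧ w.getD i 0 < w.getD j 0
      then 1 else 0 := by
  induction w with
  | nil => simp [wordLes]
  | cons a w ih =>
    cases w with
    | nil => simp [wordLes]
    | cons b t =>
      rw [wordLes, ih, countP_eq_sum_range, List.length_cons (a := a), Finset.sum_range_succ']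
      rw [List.length_cons (a := b), Finset.sum_range_succ', Finset.sum_range_succ' (n := t.length)]
      simp only [Finset.sum_range_succ' (n := t.length), Finset.sum_range_succ' (n := t.length + 1)]
      rw [add_comm]
      simp [and_comm]

theorem wordRes_eq_sum (w : List ℕ) :
    wordRes w = ∑ i ∈ Finset.range w.length, ∑ j ∈ Finset.range w.length,
      if i < j ∧ j + 1 < w.length ∧ w.getD i 0 < w.getD (j + 1) 0 ∧ w.getD j 0 < w.getD i 0
      then 1 else 0 := by
  rw [wordRes, wordLes_eq_sum, Finset.sum_comm, List.length_reverse, ← Finset.sum_range_reflect]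
  refine Finset.sum_congr rfl fun i hi => ?_
  rw [← Finset.sum_range_reflect]
  refine Finset.sum_congr rfl fun j hj => ?_
  rw [Finset.mem_range] at hi hj
  congr 1
  by_cases h : 1 ≤ w.length - 1 - j
  · simp only [List.getD_eq_getElem?_getD]
    rw [List.getElem?_reverse (by omega), List.getElem?_reverse (by omega),
      List.getElem?_reverse (by omega)]
    rw [show w.length - 1 - (w.length - 1 - i) = i by omega,
      show w.length - 1 - (w.length - 1 - j) = j by omega,
      show w.length - 1 - (w.length - 1 - j - 1) = j + 1 by omega]
    simp
    omega
  · simp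
    omega

theorem length_word {n : ℕ} (σ : Equiv.Perm (Fin n)) : (word σ).length = n := by
  simp [word]

theorem des_eq {n : ℕ} (σ : Equiv.Perm (Fin n)) : des σ = wordDes (word σ) := by
  rw [← wordDes_eq, length_word, des]

theorem sum_Icc_one_eq_sum_range (n : ℕ) (f : ℕ → ℕ) :
    ∑ i ∈ Finset.Icc 1 n, f i = ∑ i ∈ Finset.range n, f (i + 1) := by
  rw [← Finset.Ico_add_one_right_eq_Icc, Finset.sum_Ico_eq_sum_range]
  simp [add_comm]

theorem les_eq {n : ℕ} (σ : Equiv.Perm (Fin n)) : les σ = wordLes (word σ) := by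
  rw [wordLes_eq_sum, length_word, les, Finset.card_filter, Finset.sum_product,
    sum_Icc_one_eq_sum_range]
  refine Finset.sum_congr rfl fun i _ => ?_
  rw [sum_Icc_one_eq_sum_range]
  refine Finset.sum_congr rfl fun j _ => ?_
  cases i <;> simp [letter]

theorem res_eq {n : ℕ} (σ : Equiv.Perm (Fin n)) : res σ = wordRes (word σ) := by
  rw [wordRes_eq_sum, length_word, res, Finset.card_filter, Finset.sum_product,
    sum_Icc_one_eq_sum_range]
  refine Finset.sum_congr rfl fun i _ => ?_
  rw [sum_Icc_one_eq_sum_range]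
  refine Finset.sum_congr rfl fun j _ => ?_
  simp [letter]

/-! ### André words -/

/-- No letter of the word (other than its first and last one) is a double descent. -/
def NoDoubleDescent : List ℕ → Prop
  | a :: b :: c :: t => ¬ (b < a ∧ c < b) ∧ NoDoubleDescent (b :: c :: t)
  | _ => True

/-- The André condition for a word in positive letters. -/
def AndreWord (w : List ℕ) : Prop :=
  ∀ k, NoDoubleDescent (0 :: (subword w k ++ [0]))

/-- To the other letters `x` looks like `0`. It is itself a double descent only when a positive
letter precedes it and `0` follows; for empty `β` it is an end letter and nothing is asked of it. -/
theorem noDoubleDescent_append (x : ℕ) (hx : 0 < x) (α β : List ℕ) (hα : ∀ y ∈ α, y = 0 ∨ x < y)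
    (hβ : ∀ y ∈ β, y = 0 ∨ x < y) :
    NoDoubleDescent (α ++ x :: β) ↔ NoDoubleDescent (α ++ [0]) ∧ NoDoubleDescent (0 :: β) ∧
      ¬ (0 < α.getLastD 0 ∧ β.head? = some 0) := by
  induction α with
  | nil =>
    match β with
    | [] => simp [NoDoubleDescent]
    | [b] => simp [NoDoubleDescent]
    | b :: c :: t =>
      have := hβ b (by simp)
      simp [NoDoubleDescent]
      omega
  | cons a α ih =>
    have ih := ih (fun y hy => hα y (by simp [hy]))
    have ha := hα a (by simp)
    match α with
    | [] =>
      match β with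
      | [] => simp_all [NoDoubleDescent]
      | b :: t =>
        have hb := hβ b (by simp)
        simp only [List.nil_append, List.cons_append, NoDoubleDescent] at ih ⊢
        rw [ih]
        simp
        grind
    | [b] =>
      have hb := hα b (by simp)
      simp only [List.nil_append, List.cons_append, NoDoubleDescent] at ih ⊢
      rw [ih]
      simp
      grind
    | b :: c :: t =>
      simp only [List.cons_append, NoDoubleDescent] at ih ⊢
      rw [ih]
      simp
      tauto

theorem andreWord_nil : AndreWord [] := by
  intro k
  simp [subword, NoDoubleDescent]

/-- After truncation at `k ≥ x`, the letter `x` is a double descent exactly when nothing of `v`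
remains but something of `u` does. Excluding this for every `k` compares the minima of `u` and `v`.
-/
theorem andreWord_append (x : ℕ) (hx : 0 < x) (u v : List ℕ) (hu : ∀ y ∈ u, x < y)
    (hv : ∀ y ∈ v, x < y) :
    AndreWord (u ++ x :: v) ↔ AndreWord u ∧ AndreWord v ∧ ∀ z ∈ u, ∃ y ∈ v, y ≤ z := by
  have key : ∀ k, NoDoubleDescent (0 :: (subword (u ++ x :: v) k ++ [0])) ↔
      NoDoubleDescent (0 :: (subword u k ++ [0])) ∧ NoDoubleDescent (0 :: (subword v k ++ [0])) ∧
        (subword v k = [] → subword u k = []) := by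
    intro k
    by_cases hk : x ≤ k
    · have h1 : 0 :: (subword (u ++ x :: v) k ++ [0]) =
          (0 :: subword u k) ++ x :: (subword v k ++ [0]) := by simp [subword, hk]
      rw [h1, noDoubleDescent_append x hx]
      · refine and_congr Iff.rfl (and_congr Iff.rfl ?_)
        have hv' : ∀ y ∈ subword v k, x < y := fun y hy => hv y (List.mem_filter.1 hy).1
        have hu' : ∀ y ∈ subword u k, x < y := fun y hy => hu y (List.mem_filter.1 hy).1
        generalize subword u k = u' at *
        generalize subword v k = v' at *
        have h2 : 0 < (0 :: u').getLastD 0 ↔ u' ≠ [] := by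
          rcases List.eq_nil_or_concat u' with rfl | ⟨l, a, rfl⟩
          · simp
          · have := hu' a (by simp)
            have h4 : (0 :: (l ++ [a])).getLastD 0 = a := by
              rw [← List.cons_append, List.getLastD_eq_getLast?, List.getLast?_concat]
              rfl
            rw [List.concat_eq_append, h4]
            simpa using Nat.zero_lt_of_lt this
        have h3 : (v' ++ [0]).head? = some 0 ↔ v' = [] := by
          cases v' with
          | nil => simp
          | cons b t =>
            have := hv' b (by simp)
            simp
            omega
        rw [h2, h3]
        tauto
      · intro y hy
        rcases List.mem_cons.1 hy with h | h
        · exact Or.inl h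
        · exact Or.inr (hu y (List.mem_filter.1 h).1)
      · intro y hy
        rcases List.mem_append.1 hy with h | h
        · exact Or.inr (hv y (List.mem_filter.1 h).1)
        · exact Or.inl (by simpa using h)
    · have h1 : subword u k = [] := by
        rw [subword, List.filter_eq_nil_iff]
        intro y hy
        have := hu y hy
        rw [decide_eq_true_eq]
        omega
      have h2 : subword v k = [] := by
        rw [subword, List.filter_eq_nil_iff]
        intro y hy
        have := hv y hy
        rw [decide_eq_true_eq]
        omega
      have h3 : subword (u ++ x :: v) k = [] := by
        have : subword (u ++ x :: v) k = subword u k ++ subword v k := by simp [subword, hk]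
        rw [this, h1, h2, List.nil_append]
      simp [h1, h2, h3, NoDoubleDescent]
  have hcond : (∀ k, subword v k = [] → subword u k = []) ↔ ∀ z ∈ u, ∃ y ∈ v, y ≤ z := by
    simp only [subword, List.filter_eq_nil_iff, decide_eq_true_eq]
    constructor
    · intro h z hz
      by_contra! hc
      exact h z (fun y hy => not_le.2 (hc y hy)) z hz le_rfl
    · intro h k hk z hz hzk
      obtain ⟨y, hy, hyz⟩ := h z hz
      exact hk y hy (hyz.trans hzk)
  rw [← hcond]
  simp only [AndreWord, key, forall_and]

/-! ### The André condition: from positions to recursion on words -/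

theorem noDoubleDescent_iff (w : List ℕ) :
    NoDoubleDescent w ↔ ∀ i, i + 2 < w.length →
      ¬ (w.getD (i + 1) 0 < w.getD i 0 ∧ w.getD (i + 2) 0 < w.getD (i + 1) 0) := by
  induction w with
  | nil => simp [NoDoubleDescent]
  | cons a w ih =>
    match w with
    | [] => simp [NoDoubleDescent]
    | [b] => simp [NoDoubleDescent]
    | b :: c :: t =>
      rw [NoDoubleDescent, ih]
      constructor
      · rintro ⟨h1, h2⟩ i hi
        cases i with
        | zero => simpa using h1
        | succ i => simpa using h2 i (by simpa using hi)
      · intro h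
        refine ⟨by simpa using h 0 (by simp), fun i hi => ?_⟩
        simpa using h (i + 1) (by simpa using hi)

theorem noDoubleDescent_framed_iff (w : List ℕ) :
    NoDoubleDescent (0 :: (w ++ [0])) ↔ ∀ i, 1 ≤ i → i ≤ w.length → ¬ IsDoubleDescent w i := by
  have hl : ∀ i, i ≤ w.length + 1 → (0 :: (w ++ [0])).getD i 0 = letter w i := by
    intro i hi
    cases i with
    | zero => simp [letter]
    | succ i =>
      rcases Nat.lt_or_ge i w.length with h | h
      · simp [letter, List.getElem?_append_left h]
      · obtain rfl : i = w.length := by omega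
        simp [letter]
  rw [noDoubleDescent_iff]
  constructor
  · intro h i h1 h2
    obtain ⟨i, rfl⟩ : ∃ j, i = j + 1 := ⟨i - 1, by omega⟩
    have := h i (by simp; omega)
    rwa [hl _ (by omega), hl _ (by omega), hl _ (by omega)] at this
  · intro h i hi
    simp at hi
    rw [hl _ (by omega), hl _ (by omega), hl _ (by omega)]
    exact h (i + 1) (by omega) (by omega)

theorem word_perm {n : ℕ} (σ : Equiv.Perm (Fin n)) : (word σ).Perm (List.range' 1 n) := by
  have h1 : word σ = (List.ofFn σ).map (fun i : Fin n => (i : ℕ) + 1) := by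
    simp [word, List.map_ofFn, Function.comp_def]
  have h2 : (List.ofFn σ).Perm (List.finRange n) := by
    rw [List.perm_ext_iff_of_nodup (List.nodup_ofFn.2 σ.injective) (List.nodup_finRange n)]
    intro a
    simp [List.mem_ofFn, σ.surjective a]
  rw [h1]
  refine (h2.map _).trans (List.Perm.of_eq ?_)
  apply List.ext_getElem <;> simp [add_comm]

theorem length_subword_word {n : ℕ} (σ : Equiv.Perm (Fin n)) (k : ℕ) (hk : k ≤ n) :
    (subword (word σ) k).length = k := by
  rw [subword, ((word_perm σ).filter _).length_eq]
  obtain ⟨m, rfl⟩ : ∃ m, n = k + m := ⟨n - k, by omega⟩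
  rw [← List.range'_append_1, List.filter_append, List.filter_eq_self.2, List.filter_eq_nil_iff.2]
  · simp
  · intro a
    simp
    omega
  · intro a
    simp
    omega

/-- The final ascent is automatic: the last letter is followed by the framing `0`, so it would be a
double descent if it were smaller than its predecessor. -/
theorem isAndre_iff {n : ℕ} (hn : 1 ≤ n) (σ : Equiv.Perm (Fin n)) :
    IsAndre σ ↔ AndreWord (word σ) := by
  have hmem : ∀ a ∈ word σ, 1 ≤ a ∧ a ≤ n := by
    intro a ha
    have := (word_perm σ).mem_iff.1 ha
    simp at this
    omega
  constructor
  · intro h k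
    rcases Nat.eq_zero_or_pos k with rfl | hk
    · have : subword (word σ) 0 = [] := by
        rw [subword, List.filter_eq_nil_iff]
        intro a ha
        have := hmem a ha
        rw [decide_eq_true_eq]
        omega
      simp [this, NoDoubleDescent]
    · have h1 : subword (word σ) k = subword (word σ) (min k n) := by
        refine List.filter_congr fun a ha => ?_
        have := hmem a ha
        simp
        omega
      rw [h1, noDoubleDescent_framed_iff, length_subword_word _ _ (by omega)]
      exact (h (min k n) (by omega) (by omega)).1
  · intro h k h1 h2
    have hl := length_subword_word σ k h2
    have h3 := h k
    rw [noDoubleDescent_framed_iff, hl] at h3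
    refine ⟨h3, ?_⟩
    have h4 := h3 k h1 le_rfl
    have hnd : (subword (word σ) k).Nodup :=
      ((word_perm σ).nodup_iff.2 List.nodup_range').filter _
    have hpos : ∀ a ∈ subword (word σ) k, 0 < a := fun a ha => (hmem a (List.mem_filter.1 ha).1).1
    generalize subword (word σ) k = w at *
    obtain ⟨k, rfl⟩ : ∃ j, k = j + 1 := ⟨k - 1, by omega⟩
    rcases List.eq_nil_or_concat w with rfl | ⟨w, a, rfl⟩
    · simp at hl
    · simp at hl
      subst hl
      have ha : 0 < a := hpos a (by simp)
      rcases List.eq_nil_or_concat w with rfl | ⟨w, b, rfl⟩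
      · simpa [letter] using ha
      · have hab : b ≠ a := by
          rintro rfl
          simp [List.nodup_append] at hnd
        simp [IsDoubleDescent, letter] at h4 ⊢
        omega

open PowerSeries

/-! ### Weighted lattice paths and the J-fraction -/

/-- Weighted number of paths with `N` steps from height `m` that reach the height `0` exactly with
their last step, where each step from height `m` has weight `b m` or, if it goes up, `b m * c`. -/
def pathSum {K : Type*} [Field K] (b : ℕ → K) (c : K) : ℕ → ℕ → K
  | 0, 0 => 1
  | 0, _ + 1 => 0
  | _ + 1, 0 => 0
  | N + 1, m + 1 =>
    b (m + 1) * (pathSum b c N m + pathSum b c N (m + 1) + c * pathSum b c N (m + 2))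

theorem pathSum_eq_zero {K : Type*} [Field K] (b : ℕ → K) (c : K) (N m : ℕ) (h : N < m) :
    pathSum b c N m = 0 := by
  induction N generalizing m with
  | zero =>
    obtain ⟨m, rfl⟩ : ∃ j, m = j + 1 := ⟨m - 1, by omega⟩
    rw [pathSum]
  | succ N ih =>
    obtain ⟨m, rfl⟩ : ∃ j, m = j + 1 := ⟨m - 1, by omega⟩
    rw [pathSum, ih _ (by omega), ih _ (by omega), ih _ (by omega)]
    simp

/-- The generating function of the paths from height `m`, truncated at height `k`. -/
noncomputable def pathSeries {K : Type*} [Field K] (b : ℕ → K) (c : K) (k m : ℕ) : K⟦X⟧ :=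
  ∏ i ∈ Finset.range m, (C (b (i + 1)) * X *
    jConvergent (fun m => b (m + 1)) (fun m => b m * b (m + 1) * c) (k - i) i)

/-- This is the defining equation of the convergent at level `m`, multiplied by the factors of the
lower levels: a path descends through each height in turn, and each first passage contributes one
factor. -/
theorem pathSeries_succ {K : Type*} [Field K] (b : ℕ → K) (c : K) (k m : ℕ) (h : m < k) :
    pathSeries b c k (m + 1) = C (b (m + 1)) * X *
      (pathSeries b c k m + pathSeries b c k (m + 1) + C c * pathSeries b c k (m + 2)) := by
  obtain ⟨r, rfl⟩ : ∃ r, k = m + r + 1 := ⟨k - m - 1, by omega⟩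
  have h1 := jConvergent_succ_mul (fun m => b (m + 1)) (fun m => b m * b (m + 1) * c) r m
  simp only [pathSeries, Finset.prod_range_succ, show m + r + 1 - m = r + 1 by omega,
    show m + r + 1 - (m + 1) = r by omega]
  generalize (∏ i ∈ Finset.range m, (C (b (i + 1)) * X *
    jConvergent (fun m => b (m + 1)) (fun m => b m * b (m + 1) * c) (m + r + 1 - i) i)) = P
  simp only [map_mul] at h1
  linear_combination (P * C (b (m + 1)) * X) * h1

theorem coeff_pathSeries {K : Type*} [Field K] (b : ℕ → K) (c : K) (k N m : ℕ) (h : N ≤ k) :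
    coeff N (pathSeries b c k m) = pathSum b c N m := by
  induction N generalizing m with
  | zero =>
    cases m with
    | zero => simp [pathSeries, pathSum]
    | succ m => simp [pathSeries, pathSum, Finset.prod_range_succ]
  | succ N ih =>
    cases m with
    | zero => simp [pathSeries, pathSum, coeff_one]
    | succ m =>
      rcases Nat.lt_or_ge m k with hm | hm
      · rw [pathSeries_succ _ _ _ _ hm, pathSum, mul_assoc, coeff_C_mul, coeff_succ_X_mul]
        simp [ih _ (by omega : N ≤ k)]
      -- From this height `0` is out of reach in `N + 1` steps, and the product contains the
      -- convergent with no levels, which is zero.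
      · rw [pathSum_eq_zero _ _ _ _ (by omega), pathSeries,
          Finset.prod_eq_zero (i := k) (by simp; omega) (by simp [jConvergent])]
        simp

theorem coeff_jFraction_eq_pathSum {K : Type*} [Field K] (b : ℕ → K) (c : K) (hb : b 1 = 1)
    (n : ℕ) :
    coeff n (jFraction (fun m => b (m + 1)) (fun m => b m * b (m + 1) * c)) =
      pathSum b c (n + 1) 1 := by
  rw [← coeff_jConvergent _ _ n (n + 1) (by omega), ← coeff_pathSeries b c (n + 1) (n + 1) 1 le_rfl]
  simp [pathSeries, hb, coeff_succ_X_mul]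

/-! ### `(p,q)`-integers and the path form of the J-fraction -/

theorem pqNat_one {K : Type*} [Field K] (p q : K) : pqNat p q 1 = 1 := by simp [pqNat]

theorem pqNat_two {K : Type*} [Field K] (p q : K) : pqNat p q 2 = p + q := by
  simp [pqNat, Finset.sum_range_succ, add_comm]

theorem pqNat_add {K : Type*} [Field K] (p q : K) (m n : ℕ) :
    pqNat p q (m + n) = q ^ n * pqNat p q m + p ^ m * pqNat p q n := by
  rw [pqNat, Finset.sum_range_add, pqNat, pqNat, Finset.mul_sum, Finset.mul_sum]
  congr 1
  · refine Finset.sum_congr rfl fun i hi => ?_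
    rw [Finset.mem_range] at hi
    rw [show m + n - 1 - i = n + (m - 1 - i) by omega, pow_add]
    ring
  · refine Finset.sum_congr rfl fun i hi => ?_
    rw [show m + n - 1 - (m + i) = n - 1 - i by omega, pow_add]
    ring

theorem pqNat_comm {K : Type*} [Field K] (p q : K) (n : ℕ) : pqNat p q n = pqNat q p n := by
  rw [pqNat, pqNat, ← Finset.sum_range_reflect]
  refine Finset.sum_congr rfl fun i hi => ?_
  rw [Finset.mem_range] at hi
  rw [show n - 1 - (n - 1 - i) = i by omega, mul_comm]

theorem D_eq_pathSum {K : Type*} [Field K] (p q t : K) (n : ℕ) (hn : 1 ≤ n) :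
    D p q t n = pathSum (pqNat p q) (t / (p + q)) n 1 := by
  obtain ⟨n, rfl⟩ : ∃ j, n = j + 1 := ⟨n - 1, by omega⟩
  rw [← coeff_jFraction_eq_pathSum _ _ (pqNat_one p q), D, Nat.add_sub_cancel]
  congr 2
  funext m
  simp only [pqBinom, Finset.prod_range_succ, Finset.prod_range_zero, pqNat_one, pqNat_two,
    Nat.add_sub_cancel, Nat.sub_zero, zero_add, one_add_one_eq_two, one_mul]
  ring

/-! ### Configurations

A configuration is a list of pairs `(a, c)` of words. It records the maximal runs of letters `≥ k`
of an André word; a pair with `a ≠ []` records two neighbouring runs, the first of which is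
constrained to have a larger minimum than the second. -/

/-- The number of runs recorded by a pair. -/
def pairSize (x : List ℕ × List ℕ) : ℕ :=
  if x.2 = [] then 0 else if x.1 = [] then 1 else 2

/-- The word of a configuration, in which `0` separates the runs. -/
def joined (W : List (List ℕ × List ℕ)) : List ℕ :=
  W.flatMap fun x => 0 :: (x.1 ++ 0 :: x.2)

/-- The letters of a configuration. -/
def letters (W : List (List ℕ × List ℕ)) : List ℕ :=
  W.flatMap fun x => x.1 ++ x.2

/-- The condition on the pairs of a configuration. -/
def ValidPair (x : List ℕ × List ℕ) : Prop :=
  AndreWord x.1 ∧ AndreWord x.2 ∧ ∀ z ∈ x.1, ∃ y ∈ x.2, y ≤ z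

/-- The configurations of André words in the letters `k, …, k + N - 1`. -/
def Valid (k N : ℕ) (W : List (List ℕ × List ℕ)) : Prop :=
  (letters W).Perm (List.range' k N) ∧ ∀ x ∈ W, ValidPair x

/-- The total number of descents of the runs. -/
def configDes (W : List (List ℕ × List ℕ)) : ℕ :=
  (W.map fun x => wordDes x.1 + wordDes x.2).sum

/-- Insert the letter `k` between the components of the pair in position `j + 1`, and merge
the result with the pair in position `j`. -/
def insertLetter (k j : ℕ) (W : List (List ℕ × List ℕ)) : List (List ℕ × List ℕ) :=
  W.take j ++ match W.drop j with
    | x :: y :: R => (x.2, y.1 ++ k :: y.2) :: R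
    | _ => []

theorem insertLetter_append (k : ℕ) (L R : List (List ℕ × List ℕ)) (x y : List ℕ × List ℕ) :
    insertLetter k L.length (L ++ x :: y :: R) = L ++ (x.2, y.1 ++ k :: y.2) :: R := by
  simp [insertLetter]

@[simp] theorem joined_append (V W : List (List ℕ × List ℕ)) :
    joined (V ++ W) = joined V ++ joined W := by simp [joined]

@[simp] theorem joined_cons (x : List ℕ × List ℕ) (W : List (List ℕ × List ℕ)) :
    joined (x :: W) = 0 :: (x.1 ++ 0 :: (x.2 ++ joined W)) := by simp [joined]

@[simp] theorem letters_append (V W : List (List ℕ × List ℕ)) :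
    letters (V ++ W) = letters V ++ letters W := by simp [letters]

@[simp] theorem letters_cons (x : List ℕ × List ℕ) (W : List (List ℕ × List ℕ)) :
    letters (x :: W) = x.1 ++ (x.2 ++ letters W) := by simp [letters]

theorem mem_joined {W : List (List ℕ × List ℕ)} {y : ℕ} (hy : y ∈ joined W) :
    y = 0 ∨ y ∈ letters W := by
  simp only [joined, letters, List.mem_flatMap, List.mem_cons, List.mem_append] at hy ⊢
  grind

theorem ValidPair.fst_eq_nil {x : List ℕ × List ℕ} (h : ValidPair x) (h2 : x.2 = []) :
    x.1 = [] := by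
  rw [List.eq_nil_iff_forall_not_mem]
  intro z hz
  obtain ⟨y, hy, -⟩ := h.2.2 z hz
  simp [h2] at hy

theorem ValidPair.pairSize_eq {x : List ℕ × List ℕ} (h : ValidPair x) :
    pairSize x = (if x.1 = [] then 0 else 1) + (if x.2 = [] then 0 else 1) := by
  have := h.fst_eq_nil
  rw [pairSize]
  split_ifs <;> simp_all

/-- Each nonempty run is followed by a separator and so gives one drop; for valid pairs `pairSize`
counts the nonempty runs. -/
theorem dropCount_joined (W : List (List ℕ × List ℕ)) (hW : ∀ x ∈ W, ValidPair x)
    (hpos : ∀ y ∈ letters W, 0 < y) (w : List ℕ) :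
    dropCount (joined W ++ 0 :: w) = (W.map pairSize).sum + dropCount w := by
  induction W with
  | nil => simpa [joined, dropCount] using dropCount_append_zero_cons [] w
  | cons x W ih =>
    have ih := ih (fun x hx => hW x (by simp [hx])) (fun y hy => hpos y (by simp [hy]))
    have h0 : ∀ w, dropCount (0 :: w) = dropCount w := fun w => by
      simpa [dropCount] using dropCount_append_zero_cons [] w
    obtain ⟨w', hw'⟩ : ∃ w', joined W ++ 0 :: w = 0 :: w' := by cases W <;> simp [joined]
    have h1 : joined (x :: W) ++ 0 :: w = 0 :: (x.1 ++ 0 :: (x.2 ++ 0 :: w')) := by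
      rw [← hw']
      simp
    rw [h1, h0, dropCount_append_zero_cons, dropCount_append_zero_cons x.2, ← h0 w', ← hw', ih,
      dropCount_append_singleton_zero _ (fun y hy => hpos y (by simp [hy])),
      dropCount_append_singleton_zero _ (fun y hy => hpos y (by simp [hy])), List.map_cons,
      List.sum_cons, (hW x (by simp)).pairSize_eq]
    omega

theorem dropCount_reverse_append_zero (W : List (List ℕ × List ℕ)) (v : List ℕ)
    (hv : ∀ y ∈ v, 0 < y) :
    dropCount ((v ++ joined W).reverse ++ [0]) =
      dropCount (v ++ joined W).reverse + (if v = [] then 0 else 1) := by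
  have h1 := dropCount_append_singleton_zero v.reverse (by simpa using hv)
  have h2 := dropCount_of_pos v.reverse (by simpa using hv)
  simp only [List.reverse_eq_nil_iff] at h1
  cases W with
  | nil => simp [joined, h1, h2]
  | cons x W =>
    obtain ⟨w, hw⟩ : ∃ w, joined (x :: W) = 0 :: w := ⟨_, joined_cons x W⟩
    have h3 : (v ++ joined (x :: W)).reverse = w.reverse ++ 0 :: v.reverse := by simp [hw]
    rw [h3, List.append_assoc, List.cons_append, dropCount_append_zero_cons,
      dropCount_append_zero_cons _ v.reverse, h1, h2]
    omega

/-- The run `v` is not counted: read backwards it ends the word, with no separator after it. It will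
be the run adjacent to the inserted letter. -/
theorem dropCount_reverse_joined (W : List (List ℕ × List ℕ)) (hW : ∀ x ∈ W, ValidPair x)
    (hpos : ∀ y ∈ letters W, 0 < y) (v : List ℕ) (hv : ∀ y ∈ v, 0 < y) :
    dropCount (v ++ joined W).reverse = (W.map pairSize).sum := by
  induction W generalizing v with
  | nil =>
    simp only [joined, List.flatMap_nil, List.append_nil, List.map_nil, List.sum_nil]
    exact dropCount_of_pos _ (by simpa using hv)
  | cons x W ih =>
    have ih := ih (fun x hx => hW x (by simp [hx])) (fun y hy => hpos y (by simp [hy])) x.2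
      (fun y hy => hpos y (by simp [hy]))
    have hx2 := dropCount_reverse_append_zero W x.2 (fun y hy => hpos y (by simp [hy]))
    have h1 : (v ++ joined (x :: W)).reverse =
        (x.2 ++ joined W).reverse ++ 0 :: (x.1.reverse ++ 0 :: v.reverse) := by simp
    have h2 := dropCount_append_singleton_zero x.1.reverse
      (fun y hy => hpos y (by simp [List.mem_reverse.1 hy]))
    simp only [List.reverse_eq_nil_iff] at h2
    rw [h1, dropCount_append_zero_cons, dropCount_append_zero_cons x.1.reverse, hx2, ih, h2,
      dropCount_of_pos _ (by simpa using hv), List.map_cons, List.sum_cons,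
      (hW x (by simp)).pairSize_eq]
    omega

/-- The relation between a configuration and the one without its smallest letter. -/
theorem valid_insert_iff (k N : ℕ) (hk : 0 < k) (L R : List (List ℕ × List ℕ)) (a u v : List ℕ)
    (hlt : ∀ y ∈ letters (L ++ ([], a) :: (u, v) :: R), k < y) :
    Valid k (N + 1) (L ++ (a, u ++ k :: v) :: R) ↔
      Valid (k + 1) N (L ++ ([], a) :: (u, v) :: R) := by
  have hA := andreWord_append k hk u v (fun y hy => hlt y (by simp [hy]))
    (fun y hy => hlt y (by simp [hy]))
  have h1 : (letters (L ++ (a, u ++ k :: v) :: R)).Perm (List.range' k (N + 1)) ↔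
      (letters (L ++ ([], a) :: (u, v) :: R)).Perm (List.range' (k + 1) N) := by
    rw [List.range'_succ]
    refine Iff.trans ?_ (List.perm_cons k)
    have : (letters (L ++ (a, u ++ k :: v) :: R)).Perm
        (k :: letters (L ++ ([], a) :: (u, v) :: R)) := by
      have := List.perm_middle (a := k) (l₁ := letters L ++ a ++ u) (l₂ := v ++ letters R)
      simpa using this
    exact ⟨fun h => this.symm.trans h, fun h => this.trans h⟩
  rw [Valid, Valid, h1]
  refine and_congr Iff.rfl ?_
  have h2 : ValidPair (a, u ++ k :: v) ↔ ValidPair ([], a) ∧ ValidPair (u, v) := by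
    simp only [ValidPair, hA, andreWord_nil, List.not_mem_nil, false_implies, implies_true]
    constructor
    · tauto
    · rintro ⟨⟨-, ha, -⟩, h⟩
      exact ⟨ha, h, fun z hz => ⟨k, by simp, (hlt z (by simp [hz])).le⟩⟩
  simp only [List.forall_mem_append, List.forall_mem_cons, h2]
  tauto

theorem configDes_insert (k : ℕ) (L R : List (List ℕ × List ℕ)) (a u v : List ℕ)
    (hlt : ∀ y ∈ letters (L ++ ([], a) :: (u, v) :: R), k < y) :
    configDes (L ++ (a, u ++ k :: v) :: R) =
      configDes (L ++ ([], a) :: (u, v) :: R) + if u = [] then 0 else 1 := by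
  simp [configDes, wordDes, wordDes_append_min k u v (fun y hy => hlt y (by simp [hy]))
    (fun y hy => hlt y (by simp [hy]))]
  omega

/-- Here `k` takes the place of the `0` between `u` and `v`, so only drops before it matter: the
runs of `L` and `a`. The run `u` touches `k` and gives none. -/
theorem wordLes_insert (k N : ℕ) (hk : 0 < k) (L R : List (List ℕ × List ℕ)) (a u v : List ℕ)
    (hV : Valid (k + 1) N (L ++ ([], a) :: (u, v) :: R))
    (hlt : ∀ y ∈ letters (L ++ ([], a) :: (u, v) :: R), k < y) :
    wordLes (joined (L ++ (a, u ++ k :: v) :: R)) =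
      wordLes (joined (L ++ ([], a) :: (u, v) :: R)) +
        ((L.map pairSize).sum + if a = [] then 0 else 1) := by
  have h := wordLes_replace_min k hk (joined L ++ 0 :: (a ++ 0 :: u)) (v ++ joined R)
    (by
      intro y hy
      have := hlt y
      simp at hy this
      have := mem_joined (W := L) (y := y)
      grind)
    (by
      intro y hy
      have := hlt y
      simp at hy this
      have := mem_joined (W := R) (y := y)
      grind)
  have hpos : ∀ y ∈ letters (L ++ ([], a) :: (u, v) :: R), 0 < y := fun y hy => hk.trans (hlt y hy)
  have h2 : dropCount (joined L ++ 0 :: (a ++ 0 :: u)) =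
      (L.map pairSize).sum + if a = [] then 0 else 1 := by
    rw [dropCount_joined L (fun x hx => hV.2 x (by simp [hx])) (fun y hy => hpos y (by simp [hy])),
      dropCount_append_zero_cons,
      dropCount_append_singleton_zero _ (fun y hy => hpos y (by simp [hy])),
      dropCount_of_pos u (fun y hy => hpos y (by simp [hy])), add_zero]
  have h3 := wordLes_zero_zero (joined L) (a ++ 0 :: (u ++ 0 :: (v ++ joined R)))
  simp at h h3 ⊢
  rw [h, h2, h3]

theorem wordRes_insert (k N : ℕ) (hk : 0 < k) (L R : List (List ℕ × List ℕ)) (a u v : List ℕ)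
    (hV : Valid (k + 1) N (L ++ ([], a) :: (u, v) :: R))
    (hlt : ∀ y ∈ letters (L ++ ([], a) :: (u, v) :: R), k < y) :
    wordRes (joined (L ++ (a, u ++ k :: v) :: R)) =
      wordRes (joined (L ++ ([], a) :: (u, v) :: R)) + (R.map pairSize).sum := by
  have h := wordLes_replace_min k hk (v ++ joined R).reverse (joined L ++ 0 :: (a ++ 0 :: u)).reverse
    (by
      intro y hy
      have := hlt y
      simp at hy this
      have := mem_joined (W := R) (y := y)
      grind)
    (by
      intro y hy
      have := hlt y
      simp at hy this
      have := mem_joined (W := L) (y := y)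
      grind)
  have hpos : ∀ y ∈ letters (L ++ ([], a) :: (u, v) :: R), 0 < y := fun y hy => hk.trans (hlt y hy)
  rw [dropCount_reverse_joined R (fun x hx => hV.2 x (by simp [hx]))
    (fun y hy => hpos y (by simp [hy])) v (fun y hy => hpos y (by simp [hy]))] at h
  have h3 := wordRes_zero_zero (joined L) (a ++ 0 :: (u ++ 0 :: (v ++ joined R)))
  simp [wordRes] at h h3 ⊢
  rw [h, h3]

/-- Every configuration arises by insertion of its smallest letter. -/
theorem Valid.exists_eq_insert {k N : ℕ} (hk : 0 < k) {W : List (List ℕ × List ℕ)}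
    (hW : Valid k (N + 1) W) : ∃ L R a u v, W = L ++ (a, u ++ k :: v) :: R ∧
      ∀ y ∈ letters (L ++ ([], a) :: (u, v) :: R), k < y := by
  have hmin : ∀ y ∈ letters W, k ≤ y := by
    intro y hy
    have := hW.1.mem_iff.1 hy
    simp at this
    omega
  have hmem : k ∈ letters W := hW.1.mem_iff.2 (by simp)
  obtain ⟨x, hx, hkx⟩ : ∃ x ∈ W, k ∈ x.2 := by
    obtain ⟨x, hx, hkx⟩ := List.mem_flatMap.1 hmem
    rcases List.mem_append.1 hkx with h | h
    -- By minimality of `k`, the letter of the second component that is at most `k` must be `k`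
    -- itself.
    · obtain ⟨y, hy, hyk⟩ := (hW.2 x hx).2.2 k h
      have := hmin y (List.mem_flatMap.2 ⟨x, hx, by simp [hy]⟩)
      obtain rfl : y = k := by omega
      exact ⟨x, hx, hy⟩
    · exact ⟨x, hx, h⟩
  obtain ⟨L, R, rfl⟩ := List.append_of_mem hx
  obtain ⟨a, c⟩ := x
  obtain ⟨u, v, rfl⟩ := List.append_of_mem hkx
  refine ⟨L, R, a, u, v, rfl, fun y hy => ?_⟩
  have hnd : (letters (L ++ (a, u ++ k :: v) :: R)).Nodup := hW.1.nodup_iff.2 List.nodup_range'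
  have hp : (letters (L ++ (a, u ++ k :: v) :: R)).Perm
      (k :: letters (L ++ ([], a) :: (u, v) :: R)) := by
    have := List.perm_middle (a := k) (l₁ := letters L ++ a ++ u) (l₂ := v ++ letters R)
    simpa using this
  have h1 := hmin y (hp.mem_iff.2 (by simp only [List.mem_cons, hy, or_true]))
  have h2 := (List.nodup_cons.1 (hp.nodup_iff.1 hnd)).1
  have : y ≠ k := by
    rintro rfl
    exact h2 hy
  omega

theorem Valid.lt {k N : ℕ} {W : List (List ℕ × List ℕ)} (hW : Valid (k + 1) N W) :
    ∀ y ∈ letters W, k < y := by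
  intro y hy
  have := hW.1.mem_iff.1 hy
  simp at this
  omega

/-! ### Enumeration of configurations by their pair sizes -/

/-- The pair sizes after removal of the smallest letter from the pair in position `j`, where `s` is
the size of the new pair. -/
def nextShape (w : List ℕ) (j s : ℕ) : List ℕ :=
  w.take j ++ (w.getD j 0 - 1) :: s :: w.drop (j + 1)

/-- The configurations in the letters `k, …, k + N - 1` with pair sizes `w`. -/
def configs : ℕ → ℕ → List ℕ → Finset (List (List ℕ × List ℕ))
  | 0, _, w => if w.sum = 0 then {w.map fun _ => ([], [])} else ∅
  | N + 1, k, w =>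
    ((Finset.range w.length ×ˢ Finset.range 3).filter fun x => 0 < w.getD x.1 0).biUnion fun x =>
      (configs N (k + 1) (nextShape w x.1 x.2)).image (insertLetter k x.1)

theorem take_append_getD_cons_drop {w : List ℕ} {j : ℕ} (hj : j < w.length) :
    w.take j ++ w.getD j 0 :: w.drop (j + 1) = w := by
  simp [hj]

theorem getD_le_two {w : List ℕ} (hw : ∀ s ∈ w, s ≤ 2) (j : ℕ) : w.getD j 0 ≤ 2 := by
  rcases Nat.lt_or_ge j w.length with h | h
  · simpa [h] using hw _ (List.getElem_mem h)
  · simp [h]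

theorem nextShape_le_two {w : List ℕ} (hw : ∀ s ∈ w, s ≤ 2) (j : ℕ) {s : ℕ} (hs : s < 3) :
    ∀ s' ∈ nextShape w j s, s' ≤ 2 := by
  intro s' hs'
  have := getD_le_two hw j
  simp only [nextShape, List.mem_append, List.mem_cons] at hs'
  rcases hs' with h | h | h | h
  · exact hw _ (List.mem_of_mem_take h)
  · omega
  · omega
  · exact hw _ (List.mem_of_mem_drop h)

theorem pairSize_insert (k : ℕ) (a u v : List ℕ) :
    pairSize (a, u ++ k :: v) = pairSize ([], a) + 1 := by
  simp only [pairSize]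
  split_ifs <;> simp_all

theorem Valid.eq_append_of_shape {k N : ℕ} {W : List (List ℕ × List ℕ)} (hW : Valid k N W)
    {w : List ℕ} (hw : ∀ s ∈ w, s ≤ 2) {j s : ℕ} (hj : j < w.length) (hs : 0 < w.getD j 0)
    (h : W.map pairSize = nextShape w j s) :
    ∃ L R a u v, W = L ++ ([], a) :: (u, v) :: R ∧ L.length = j ∧ L.map pairSize = w.take j ∧
      pairSize ([], a) + 1 = w.getD j 0 ∧ pairSize (u, v) = s ∧ R.map pairSize = w.drop (j + 1) := by
  rw [nextShape, List.map_eq_append_iff] at h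
  obtain ⟨L, W', rfl, hL, hW'⟩ := h
  rw [List.map_eq_cons_iff] at hW'
  obtain ⟨⟨b, a⟩, W', rfl, hx, hW'⟩ := hW'
  rw [List.map_eq_cons_iff] at hW'
  obtain ⟨⟨u, v⟩, R, rfl, hy, hR⟩ := hW'
  -- The size of this pair is an entry at most 2, minus one, so its two components cannot both be
  -- nonempty.
  have hb : b = [] := by
    have h1 := (hW.2 (b, a) (by simp)).fst_eq_nil
    have h2 := getD_le_two hw j
    rw [pairSize] at hx
    by_contra hb
    split_ifs at hx with h3
    · exact hb (h1 h3)
    · omega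
  subst hb
  refine ⟨L, R, a, u, v, rfl, ?_, hL, by omega, hy, hR⟩
  have := congrArg List.length hL
  simp at this
  omega

theorem mem_configs (N k : ℕ) (hk : 0 < k) (w : List ℕ) (hw : ∀ s ∈ w, s ≤ 2)
    (W : List (List ℕ × List ℕ)) :
    W ∈ configs N k w ↔ Valid k N W ∧ W.map pairSize = w := by
  induction N generalizing k w W with
  | zero =>
    have h0 : letters W = [] ↔ ∀ x ∈ W, x = ([], []) := by
      simp [letters, Prod.ext_iff]
    simp only [configs, Valid, List.range'_zero, List.perm_nil, h0]
    constructor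
    · intro h
      split_ifs at h with hs
      · rw [Finset.mem_singleton] at h
        subst h
        refine ⟨⟨by simp, ?_⟩, ?_⟩
        · intro x hx
          obtain ⟨-, -, rfl⟩ := List.mem_map.1 hx
          simp [ValidPair, andreWord_nil]
        · rw [List.map_map]
          conv_rhs => rw [← List.map_id w]
          refine List.map_congr_left fun s hs' => ?_
          rw [List.sum_eq_zero_iff] at hs
          simp [pairSize, hs s hs']
      · simp at h
    · rintro ⟨⟨h, -⟩, rfl⟩
      rw [if_pos, Finset.mem_singleton, List.map_map]
      · conv_lhs => rw [← List.map_id W]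
        exact List.map_congr_left fun x hx => h x hx
      · rw [List.sum_eq_zero_iff]
        intro s hs
        obtain ⟨x, hx, rfl⟩ := List.mem_map.1 hs
        simp [pairSize, h x hx]
  | succ N ih =>
    simp only [configs, Finset.mem_biUnion, Finset.mem_filter, Finset.mem_product, Finset.mem_range,
      Finset.mem_image, Prod.exists]
    constructor
    · rintro ⟨j, s, ⟨⟨hj, hs⟩, hpos⟩, W', hW', rfl⟩
      rw [ih _ (by omega) _ (nextShape_le_two hw j hs)] at hW'
      obtain ⟨hV, hsh⟩ := hW'
      obtain ⟨L, R, a, u, v, rfl, rfl, hL, ha, -, hR⟩ := hV.eq_append_of_shape hw hj hpos hsh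
      rw [insertLetter_append]
      refine ⟨(valid_insert_iff k N hk L R a u v hV.lt).2 hV, ?_⟩
      rw [List.map_append, List.map_cons, pairSize_insert, hL, hR, ha,
        take_append_getD_cons_drop hj]
    · rintro ⟨hV, rfl⟩
      obtain ⟨L, R, a, u, v, rfl, hlt⟩ := hV.exists_eq_insert hk
      have hV' := (valid_insert_iff k N hk L R a u v hlt).1 hV
      have h3 : pairSize (u, v) < 3 := by
        rw [pairSize]
        split_ifs <;> omega
      refine ⟨L.length, pairSize (u, v), ⟨⟨by simp, h3⟩, ?_⟩, L ++ ([], a) :: (u, v) :: R, ?_,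
        insertLetter_append k L R _ _⟩
      · simp [pairSize_insert]
      · rw [ih _ (by omega) _ (nextShape_le_two hw _ h3)]
        refine ⟨hV', ?_⟩
        simp [nextShape, pairSize_insert, List.drop_append]

/-- A letter `k` occurs in a unique pair of `insertLetter k j W`, which determines `j` and `W`. -/
theorem insertLetter_inj {k : ℕ} {L L' R R' : List (List ℕ × List ℕ)} {a u v a' u' v' : List ℕ}
    (h : ∀ y ∈ letters (L ++ ([], a) :: (u, v) :: R), k < y)
    (h' : ∀ y ∈ letters (L' ++ ([], a') :: (u', v') :: R'), k < y)
    (heq : L ++ (a, u ++ k :: v) :: R = L' ++ (a', u' ++ k :: v') :: R') :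
    L = L' ∧ a = a' ∧ u = u' ∧ v = v' ∧ R = R' := by
  induction L generalizing L' with
  | nil =>
    cases L' with
    | nil =>
      simp only [List.nil_append, List.cons.injEq, Prod.mk.injEq] at heq
      obtain ⟨⟨h1, h2⟩, h3⟩ := heq
      have hu : k ∉ u := fun hk => (h k (by simp [hk])).false
      have hv : k ∉ v := fun hk => (h k (by simp [hk])).false
      rw [List.append_cons_inj_of_notMem hu hv] at h2
      exact ⟨rfl, h1, h2.1, h2.2.2, h3⟩
    | cons x L' =>
      simp only [List.nil_append, List.cons_append, List.cons.injEq] at heq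
      have := h' k (by simp [← heq.1])
      omega
  | cons x L ih =>
    cases L' with
    | nil =>
      simp only [List.nil_append, List.cons_append, List.cons.injEq] at heq
      have := h k (by simp [heq.1])
      omega
    | cons x' L' =>
      simp only [List.cons_append, List.cons.injEq] at heq
      obtain ⟨h1, h2⟩ := ih (fun y hy => h y (by simp_all)) (fun y hy => h' y (by simp_all)) heq.2
      exact ⟨by rw [heq.1, h1], h2⟩

/-- A new descent is paid for by the bound pair `(u, v)` that disappears, and a new bound pair `(a,
u ++ k :: v)` by the pattern that `k` forms with the drop after `a`. With `s` the size of `(u, v)`,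
the sum of sizes changes by `1 - s`, and a descent appears only for `s = 2`, so the second left side
grows by at most 1. -/
theorem des_add_count_le (N k : ℕ) (hk : 0 < k) (W : List (List ℕ × List ℕ)) (hW : Valid k N W) :
    configDes W + (W.map pairSize).count 2 ≤ wordLes (joined W) ∧
      2 * configDes W + (W.map pairSize).sum ≤ N := by
  induction N generalizing k W with
  | zero =>
    have h0 : ∀ x ∈ W, x = ([], []) := by
      have := hW.1
      simpa [letters, Prod.ext_iff] using this
    have h1 : W = W.map fun _ => ([], []) := by
      conv_lhs => rw [← List.map_id W]
      exact List.map_congr_left fun x hx => h0 x hx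
    rw [h1]
    simp [configDes, wordDes, pairSize, List.count_replicate]
  | succ N ih =>
    obtain ⟨L, R, a, u, v, rfl, hlt⟩ := hW.exists_eq_insert hk
    have hV := (valid_insert_iff k N hk L R a u v hlt).1 hW
    have ih := ih (k + 1) (by omega) _ hV
    have h2 := (hV.2 (u, v) (by simp)).fst_eq_nil
    rw [configDes_insert k L R a u v hlt, wordLes_insert k N hk L R a u v hV hlt]
    simp only [List.map_append, List.map_cons, pairSize_insert, List.count_append, List.count_cons,
      List.sum_append, List.sum_cons, beq_iff_eq] at ih ⊢
    simp only [pairSize] at ih h2 ⊢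
    by_cases hu : u = [] <;> by_cases hv : v = [] <;> by_cases ha : a = [] <;>
      simp_all <;> omega

/-! ### The weighted sum over configurations -/

/-- The weight of a configuration. -/
def weight {K : Type*} [Field K] (p q t : K) (W : List (List ℕ × List ℕ)) : K :=
  p ^ wordRes (joined W) * q ^ wordLes (joined W) * t ^ configDes W

theorem sum_configs_succ {K : Type*} [Field K] (p q t : K) (N k : ℕ) (hk : 0 < k) (w : List ℕ)
    (hw : ∀ s ∈ w, s ≤ 2) :
    ∑ W ∈ configs (N + 1) k w, weight p q t W =
      ∑ j ∈ Finset.range w.length, ∑ s ∈ Finset.range 3, if 0 < w.getD j 0 then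
        p ^ (w.drop (j + 1)).sum * q ^ ((w.take j).sum + (w.getD j 0 - 1)) *
          t ^ (if s = 2 then 1 else 0) *
          ∑ W ∈ configs N (k + 1) (nextShape w j s), weight p q t W else 0 := by
  have hdec : ∀ j s, j < w.length → s < 3 → 0 < w.getD j 0 →
      ∀ W ∈ configs N (k + 1) (nextShape w j s), ∃ L R a u v,
        W = L ++ ([], a) :: (u, v) :: R ∧ L.length = j ∧ L.map pairSize = w.take j ∧
        pairSize ([], a) + 1 = w.getD j 0 ∧ pairSize (u, v) = s ∧
        R.map pairSize = w.drop (j + 1) ∧ Valid (k + 1) N W := by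
    intro j s hj hs hpos W hW
    rw [mem_configs _ _ (by omega) _ (nextShape_le_two hw j hs)] at hW
    obtain ⟨L, R, a, u, v, h⟩ := hW.1.eq_append_of_shape hw hj hpos hW.2
    exact ⟨L, R, a, u, v, h.1, h.2.1, h.2.2.1, h.2.2.2.1, h.2.2.2.2.1, h.2.2.2.2.2, hW.1⟩
  rw [configs, Finset.sum_biUnion, ← Finset.sum_product', Finset.sum_filter]
  · refine Finset.sum_congr rfl ?_
    rintro ⟨j, s⟩ hx
    rw [Finset.mem_product, Finset.mem_range, Finset.mem_range] at hx
    dsimp only at hx ⊢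
    by_cases hpos : 0 < w.getD j 0
    · rw [if_pos hpos, if_pos hpos, Finset.sum_image, Finset.mul_sum]
      · refine Finset.sum_congr rfl fun W hW => ?_
        obtain ⟨L, R, a, u, v, rfl, rfl, hL, ha, hs, hR, hV⟩ := hdec _ _ hx.1 hx.2 hpos W hW
        have h1 : (if a = [] then 0 else 1) = w.getD L.length 0 - 1 := by
          rw [← ha]
          simp [pairSize]
        have h2 : (if u = [] then 0 else 1) = if s = 2 then 1 else 0 := by
          have := (hV.2 (u, v) (by simp)).fst_eq_nil
          rw [← hs, pairSize]
          split_ifs <;> simp_all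
        rw [insertLetter_append, weight, weight, configDes_insert k L R a u v hV.lt,
          wordLes_insert k N hk L R a u v hV hV.lt, wordRes_insert k N hk L R a u v hV hV.lt,
          hL, hR, h1, h2]
        generalize (if s = 2 then 1 else 0) = e
        ring
      · intro W hW W' hW' heq
        obtain ⟨L, R, a, u, v, rfl, hl, -, -, -, -, hV⟩ := hdec _ _ hx.1 hx.2 hpos W hW
        obtain ⟨L', R', a', u', v', rfl, hl', -, -, -, -, hV'⟩ := hdec _ _ hx.1 hx.2 hpos W' hW'
        rw [← hl, insertLetter_append, hl, ← hl', insertLetter_append] at heq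
        obtain ⟨rfl, rfl, rfl, rfl, rfl⟩ := insertLetter_inj hV.lt hV'.lt heq
        rfl
    · rw [if_neg hpos, if_neg hpos]
  -- Disjointness: the place of `k` determines `L`, `u` and `v`, hence `j` and `s`.
  · rintro ⟨j, s⟩ hx ⟨j', s'⟩ hx' hne
    simp only [Finset.coe_filter, Finset.mem_product, Finset.mem_range, Set.mem_ofPred_eq] at hx hx'
    rw [Function.onFun, Finset.disjoint_left]
    intro V hV1 hV2
    obtain ⟨W, hW, rfl⟩ := Finset.mem_image.1 hV1
    obtain ⟨W', hW', heq⟩ := Finset.mem_image.1 hV2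
    obtain ⟨L, R, a, u, v, rfl, rfl, -, -, hs, -, hV⟩ := hdec _ _ hx.1.1 hx.1.2 hx.2 W hW
    obtain ⟨L', R', a', u', v', rfl, rfl, -, -, hs', -, hV'⟩ :=
      hdec _ _ hx'.1.1 hx'.1.2 hx'.2 W' hW'
    rw [insertLetter_append, insertLetter_append] at heq
    obtain ⟨rfl, rfl, rfl, rfl, rfl⟩ := insertLetter_inj hV'.lt hV.lt heq
    exact hne (by rw [← hs, ← hs'])

/-- The `w.sum` monomials of the total are cut into consecutive blocks of lengths given by `w`. -/
theorem sum_pow_mul_pqNat {K : Type*} [Field K] (p q : K) (w : List ℕ) :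
    ∑ j ∈ Finset.range w.length,
      p ^ (w.drop (j + 1)).sum * q ^ (w.take j).sum * pqNat p q (w.getD j 0) =
        pqNat p q w.sum := by
  induction w with
  | nil => simp [pqNat]
  | cons s w ih =>
    rw [List.sum_cons, pqNat_comm p q (s + _), pqNat_add, List.length_cons, Finset.sum_range_succ',
      ← pqNat_comm p q, ← pqNat_comm p q, ← ih, Finset.mul_sum, add_comm]
    congr 1
    · simp
    · refine Finset.sum_congr rfl fun j _ => ?_
      simp [pow_add]
      ring

theorem weight_empty {K : Type*} [Field K] (p q t : K) (w : List ℕ) :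
    weight p q t (w.map fun _ => ([], [])) = 1 := by
  induction w with
  | nil => simp [weight, joined, configDes, wordRes, wordLes]
  | cons s w ih =>
    rw [← ih]
    simp [weight, configDes, wordDes, wordLes_zero_cons, wordRes_zero_cons]

/-- The factor `r` per bound pair makes the sum depend on the shape only through `w.sum` and the
number of such pairs, so that the recursion closes. -/
theorem sum_configs {K : Type*} [Field K] (p q t r : K) (hr : r * (p + q) = q) (N k : ℕ)
    (hk : 0 < k) (w : List ℕ) (hw : ∀ s ∈ w, s ≤ 2) :
    ∑ W ∈ configs N k w, weight p q t W =
      r ^ w.count 2 * pathSum (pqNat p q) (r * t) N w.sum := by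
  induction N generalizing k w with
  | zero =>
    rw [configs]
    split_ifs with h
    · have h2 : w.count 2 = 0 := by
        rw [List.count_eq_zero]
        intro h2
        have := List.sum_eq_zero_iff.1 h 2 h2
        omega
      rw [Finset.sum_singleton, weight_empty, h, h2, pathSum, pow_zero, one_mul]
    · obtain ⟨m, hm⟩ := Nat.exists_eq_succ_of_ne_zero h
      simp [hm, pathSum]
  | succ N ih =>
    rw [sum_configs_succ p q t N k hk w hw]
    rcases Nat.eq_zero_or_pos w.sum with h0 | h0
    · rw [h0, pathSum, mul_zero]
      refine Finset.sum_eq_zero fun j hj => Finset.sum_eq_zero fun s _ => if_neg ?_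
      rw [Finset.mem_range] at hj
      have := List.sum_eq_zero_iff.1 h0 _ (List.getElem_mem hj)
      simp [this, hj]
    · obtain ⟨m, hm⟩ : ∃ m, w.sum = m + 1 := ⟨w.sum - 1, by omega⟩
      have hP := sum_pow_mul_pqNat p q w
      rw [hm] at hP
      rw [hm, pathSum, ← hP, Finset.sum_mul, Finset.mul_sum]
      refine Finset.sum_congr rfl fun j hj => ?_
      rw [Finset.mem_range] at hj
      have hS : w.sum = (w.take j).sum + (w.getD j 0 + (w.drop (j + 1)).sum) := by
        conv_lhs => rw [← take_append_getD_cons_drop hj]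
        simp
      have hC : w.count 2 = (w.take j).count 2 + ((w.drop (j + 1)).count 2 +
          if w.getD j 0 = 2 then 1 else 0) := by
        conv_lhs => rw [← take_append_getD_cons_drop hj]
        simp [List.count_append, List.count_cons]
      rcases Nat.eq_zero_or_pos (w.getD j 0) with hz | hz
      · simp only [hz, lt_irrefl, if_false, Finset.sum_const_zero]
        simp [pqNat]
      have h2 := getD_le_two hw j
      have hI : ∀ s < 3, ∑ W ∈ configs N (k + 1) (nextShape w j s), weight p q t W =
          r ^ ((w.take j).count 2 + (w.drop (j + 1)).count 2 + if s = 2 then 1 else 0) *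
            pathSum (pqNat p q) (r * t) N (m + s) := by
        intro s hs
        rw [ih (k + 1) (by omega) _ (nextShape_le_two hw j hs)]
        have h3 : (nextShape w j s).sum = m + s := by
          simp only [nextShape, List.sum_append, List.sum_cons]
          omega
        have h4 : (nextShape w j s).count 2 =
            (w.take j).count 2 + (w.drop (j + 1)).count 2 + if s = 2 then 1 else 0 := by
          simp only [nextShape, List.count_append, List.count_cons, beq_iff_eq]
          rw [if_neg (by omega : ¬ w.getD j 0 - 1 = 2)]
          omega
        rw [h3, h4]
      simp only [Finset.sum_range_succ, Finset.sum_range_zero, if_pos hz, hI 0 (by omega),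
        hI 1 (by omega), hI 2 (by omega), hC]
      generalize w.getD j 0 = g at *
      obtain rfl | rfl : g = 1 ∨ g = 2 := by omega
      · simp [pqNat_one, pow_add]
        ring
      -- A bound pair is broken up: the recursion supplies `q`, the claim needs `r * [2]`, and `hr`
      -- equates them.
      · simp [pqNat_two, pow_add]
        linear_combination (-(p ^ (w.drop (j + 1)).sum * q ^ (w.take j).sum *
          r ^ (w.take j).count 2 * r ^ (w.drop (j + 1)).count 2 *
          (pathSum (pqNat p q) (r * t) N m + pathSum (pqNat p q) (r * t) N (m + 1) +
            r * t * pathSum (pqNat p q) (r * t) N (m + 2)))) * hr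

/-! ### André permutations as configurations -/

theorem exists_word_eq {n : ℕ} {w : List ℕ} (hw : w.Perm (List.range' 1 n)) :
    ∃ σ : Equiv.Perm (Fin n), word σ = w := by
  have hl : w.length = n := by simpa using hw.length_eq
  subst hl
  have hmem : ∀ i : Fin w.length, 1 ≤ w[i] ∧ w[i] ≤ w.length := by
    intro i
    have := hw.mem_iff.1 (List.getElem_mem i.2)
    simp at this
    exact ⟨this.1, by simpa using (by omega : w[(i : ℕ)] ≤ w.length)⟩
  have hnd : w.Nodup := hw.nodup_iff.2 List.nodup_range'
  let f : Fin w.length → Fin w.length := fun i => ⟨w[i] - 1, by have := hmem i; omega⟩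
  have hf : Function.Injective f := by
    intro i j hij
    have h1 := hmem i
    have h2 := hmem j
    have h3 : w[i] = w[j] := by
      have := congrArg Fin.val hij
      simp only [f] at this
      omega
    exact Fin.ext ((hnd.getElem_inj_iff).1 h3)
  refine ⟨Equiv.ofBijective f (Finite.injective_iff_bijective.1 hf), ?_⟩
  refine List.ext_getElem (by simp [word]) fun i h1 h2 => ?_
  have := hmem ⟨i, h2⟩
  simp only [Fin.getElem_fin] at this
  simp [word, f]
  omega

theorem word_injective {n : ℕ} : Function.Injective (word (n := n)) := by
  intro σ τ h
  rw [word, word, List.ofFn_inj] at h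
  ext i
  have := congrFun h i
  omega

theorem valid_singleton_iff (n : ℕ) (c : List ℕ) :
    Valid 1 n [([], c)] ↔ c.Perm (List.range' 1 n) ∧ AndreWord c := by
  simp [Valid, letters, ValidPair, andreWord_nil]

theorem valid_word_iff {n : ℕ} (hn : 1 ≤ n) (σ : Equiv.Perm (Fin n)) :
    Valid 1 n [([], word σ)] ↔ σ ∈ andre n := by
  simp [valid_singleton_iff, andre, isAndre_iff hn, word_perm]

theorem pairSize_word {n : ℕ} (hn : 1 ≤ n) (σ : Equiv.Perm (Fin n)) :
    pairSize ([], word σ) = 1 := by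
  have : word σ ≠ [] := by
    intro h
    have := length_word σ
    simp [h] at this
    omega
  simp [pairSize, this]

theorem weight_word {K : Type*} [Field K] (p q t : K) {n : ℕ} (σ : Equiv.Perm (Fin n)) :
    weight p q t [([], word σ)] = p ^ res σ * q ^ les σ * t ^ des σ := by
  rw [res_eq, les_eq, des_eq]
  simp [weight, joined, configDes, wordDes, wordLes_zero_cons, wordRes_zero_cons]

theorem sum_andre {K : Type*} [Field K] (p q t : K) (n : ℕ) (hn : 1 ≤ n) :
    ∑ σ ∈ andre n, p ^ res σ * q ^ les σ * t ^ des σ = ∑ W ∈ configs n 1 [1], weight p q t W := by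
  have hmem := mem_configs n 1 one_pos [1] (by simp)
  refine Finset.sum_bij (fun σ _ => [([], word σ)]) ?_ ?_ ?_ ?_
  · intro σ hσ
    rw [hmem, valid_word_iff hn]
    exact ⟨hσ, by simp [pairSize_word hn]⟩
  · intro σ _ τ _ h
    exact word_injective (by simpa using h)
  · intro W hW
    rw [hmem] at hW
    obtain ⟨hV, hW⟩ := hW
    rw [List.map_eq_singleton_iff] at hW
    obtain ⟨⟨a, c⟩, rfl, hac⟩ := hW
    obtain rfl : a = [] := by
      rw [pairSize] at hac
      split_ifs at hac with h1 h2
      · exact h2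
      · omega
    obtain ⟨σ, rfl⟩ := exists_word_eq ((valid_singleton_iff n c).1 hV).1
    exact ⟨σ, (valid_word_iff hn σ).1 hV, rfl⟩
  · intro σ _
    rw [weight_word]

theorem des_le_les {n : ℕ} (hn : 1 ≤ n) {σ : Equiv.Perm (Fin n)} (hσ : σ ∈ andre n) :
    des σ ≤ les σ ∧ 2 * des σ + 1 ≤ n := by
  have h := des_add_count_le n 1 one_pos _ ((valid_word_iff hn σ).2 hσ)
  rw [les_eq, des_eq]
  simpa [joined, configDes, wordDes, wordLes_zero_cons, pairSize_word hn] using h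

theorem D_eq_sum_andre {K : Type*} [Field K] (p q t : K) (hq : q ≠ 0) (hpq : p + q ≠ 0) (n : ℕ)
    (hn : 1 ≤ n) :
    D p q t n = ∑ σ ∈ andre n, p ^ res σ * q ^ ((les σ : ℤ) - (des σ : ℤ)) * t ^ des σ := by
  -- The factor `q ^ (-des)` is absorbed into `t`, so `sum_configs` applies with `t / q`.
  have h1 : ∑ σ ∈ andre n, p ^ res σ * q ^ ((les σ : ℤ) - (des σ : ℤ)) * t ^ des σ =
      ∑ σ ∈ andre n, p ^ res σ * q ^ les σ * (t / q) ^ des σ := by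
    refine Finset.sum_congr rfl fun σ _ => ?_
    rw [zpow_sub₀ hq, zpow_natCast, zpow_natCast, div_pow]
    ring
  rw [h1, sum_andre _ _ _ n hn, sum_configs p q (t / q) (q / (p + q)) (div_mul_cancel₀ _ hpq) n 1
    one_pos _ (by simp), D_eq_pathSum p q t n hn]
  have : q / (p + q) * (t / q) = t / (p + q) := by field_simp
  simp [this]

theorem sum_d_mul_pow {K : Type*} [Field K] (p q t : K) (n : ℕ) (hn : 1 ≤ n) :
    ∑ k ∈ Finset.range ((n - 1) / 2 + 1), d p q n k * t ^ k =
      ∑ σ ∈ andre n, p ^ res σ * q ^ ((les σ : ℤ) - (des σ : ℤ)) * t ^ des σ := by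
  have hmap : ∀ σ ∈ andre n, des σ ∈ Finset.range ((n - 1) / 2 + 1) := by
    intro σ hσ
    have := (des_le_les hn hσ).2
    rw [Finset.mem_range]
    omega
  rw [← Finset.sum_fiberwise_of_maps_to hmap]
  refine Finset.sum_congr rfl fun k _ => ?_
  rw [d, Finset.sum_mul, andreDes]
  refine Finset.sum_congr rfl fun σ hσ => ?_
  rw [(Finset.mem_filter.1 hσ).2]

theorem qVar_ne_zero : qVar ≠ 0 := by
  rw [qVar, Ne, FaithfulSMul.algebraMap_eq_zero_iff]
  exact MvPolynomial.X_ne_zero 1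

theorem pVar_add_qVar_ne_zero : pVar + qVar ≠ 0 := by
  rw [pVar, qVar, ← map_add, Ne, FaithfulSMul.algebraMap_eq_zero_iff]
  intro h
  simpa using congrArg (MvPolynomial.eval fun _ => (1 : ℤ)) h

end AndrePermutation

/-- For `n ≥ 1`: every André permutation `σ` of `{1, …, n}` has `les σ ≥ des σ` (so that the sums
below are polynomials), and in `ℚ(p,q,t)`
`D_n(p,q,t) = ∑_k d_{n,k}(p,q) t^k = ∑_{σ ∈ 𝔇_n} p^{res σ} q^{les σ - des σ} t^{des σ}`. -/
theorem mainTheorem3 (n : ℕ) (hn : 1 ≤ n) :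
    (∀ σ ∈ AndrePermutation.andre n, AndrePermutation.des σ ≤ AndrePermutation.les σ) ∧
    AndrePermutation.D AndrePermutation.pVar AndrePermutation.qVar AndrePermutation.tVar n =
      ∑ k ∈ Finset.range ((n - 1) / 2 + 1),
        AndrePermutation.d AndrePermutation.pVar AndrePermutation.qVar n k *
          AndrePermutation.tVar ^ k ∧
    AndrePermutation.D AndrePermutation.pVar AndrePermutation.qVar AndrePermutation.tVar n =
      ∑ σ ∈ AndrePermutation.andre n,
        AndrePermutation.pVar ^ AndrePermutation.res σ *
          AndrePermutation.qVar ^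
            ((AndrePermutation.les σ : ℤ) - (AndrePermutation.des σ : ℤ)) *
          AndrePermutation.tVar ^ AndrePermutation.des σ := by
  have h := AndrePermutation.D_eq_sum_andre AndrePermutation.pVar AndrePermutation.qVar
    AndrePermutation.tVar AndrePermutation.qVar_ne_zero AndrePermutation.pVar_add_qVar_ne_zero n hn
  exact ⟨fun σ hσ => (AndrePermutation.des_le_les hn hσ).1,
    h.trans (AndrePermutation.sum_d_mul_pow _ _ _ n hn).symm, h⟩
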